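/- Consider a Bayesian bandit problem with finitely many (at least one) arms. The mean rewards $\mu_i\in[0,1]$ of the arms are independent, $\mu_i$ being drawn from a prior $\mathcal P_i$ on $[0,1]$, and given the mean rewards every sample of arm $i$ is an independent Bernoulli variable with mean $\mu_i$. In each round $t$ an algorithm, possibly randomized, recommends an arm $A_t$ based on the arms and rewards of the past rounds, and it observes the reward of that arm. It is BIC over a time horizon $T\in\mathbb N\cup\{\infty\}$ if, when all past recommendations have been followed, for all rounds $t\le T$ and all arms $i,j$ with $\Pr[A_t=i]>0$, $$\mathbb E[\mu_i-\mu_j\mid A_t=i]\ge 0 .$$ Arm $i$ satisfies pairwise non-dominance if $\Pr[\mu_j<\mathbb E[\mu_i]]>0$ for all arms $j\ne i$. Arm $i$ is support-degenerate if, for some $x\in[0,1)$, $\mu_i\in\{x,1\}$ almost surely. **Theorem.** Suppose that no arm is support-degenerate, and let $S$ be the set of all arms that satisfy pairwise non-dominance. (a) For each arm $i$: there are a horizon $T$ and an algorithm that is BIC over $T$ and samples arm $i$ with positive probability within its horizon, if and only if $i\in S$. (b) The set $S$ is nonempty, and all arms of the instance in which only the arms of $S$ are present satisfy pairwise non-dominance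 in that instance. Any algorithm for this restricted instance that is BIC over a horizon $T$ in it is also BIC over $T$ as an algorithm for the instance with all arms. In particular, if an algorithm (a recipe that assigns a bandit algorithm to every finite nonempty set of arms with priors) is BIC over $T$ on every instance all of whose arms satisfy pairwise non-dominance, then its restriction to the arms in $S$ is BIC over $T$ for the instance with all arms. (c) There are a finite time $t^*$, depending on the priors, and an algorithm that is BIC over the infinite horizon, such that almost surely this algorithm samples every arm of $S$ within the first $t^*$ rounds. -/

import Mathlib

open MeasureTheory ProbabilityTheory
open scoped unitInterval

universe u

noncomputable section

namespace IncentivizedExploration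

/-- The prior distributions of the mean rewards, one for each arm: probability measures on
`[0,1]`. The mean rewards of different arms are independent. -/
abbrev Priors (ι : Type u) : Type u := ι → ProbabilityMeasure I

/-- The prior mean reward `E[μ_i]` of arm `i`. -/
def priorMean {ι : Type u} (P : Priors ι) (i : ι) : ℝ :=
  ∫ x : I, (x : ℝ) ∂(P i : Measure I)

/-- Arm `i` satisfies pairwise non-dominance: `Pr[μ_j < E[μ_i]] > 0` for all arms `j ≠ i`. -/
def NonDominated {ι : Type u} (P : Priors ι) (i : ι) : Prop :=
  ∀ j, j ≠ i → 0 < (P j : Measure I) {x : I | (x : ℝ) < priorMean P i}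

/-- Arm `i` is support-degenerate: its mean reward is almost surely in `{x, 1}`, for some
`x ∈ [0,1)`. -/
def SupportDegenerate {ι : Type u} (P : Priors ι) (i : ι) : Prop :=
  ∃ x : I, x < 1 ∧ ∀ᵐ y ∂(P i : Measure I), y = x ∨ y = 1

/-- The set `S` of all arms that satisfy pairwise non-dominance. -/
def nonDominatedArms {ι : Type u} (P : Priors ι) : Set ι :=
  {i | NonDominated P i}

/-- The priors of the problem instance in which only the arms in `S` are present. -/
def Priors.restrict {ι : Type u} (P : Priors ι) (S : Set ι) : Priors S :=
  fun i => P i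

/-- A history: the pairs (recommended arm, realized reward) of the past rounds, the most recent
round first. Rewards are Bernoulli; `true` stands for reward `1` and `false` for reward `0`. -/
abbrev History (ι : Type u) : Type u := List (ι × Bool)

/-- A randomized bandit algorithm over the set `ι` of arms: it draws an internal random seed once,
and in each round recommends an arm as a function of the history and the seed. -/
structure BanditAlgorithm (ι : Type u) where
  /-- The space of internal random seeds. -/
  Seed : Type
  [measurableSpaceSeed : MeasurableSpace Seed]
  /-- The distribution of the internal random seed. -/
  seedLaw : ProbabilityMeasure Seed
  /-- The recommended arm, given the history and the seed. -/
  act : History ι → Seed → ι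
  measurableSet_act : ∀ h i, MeasurableSet {s | act h s = i}

attribute [instance] BanditAlgorithm.measurableSpaceSeed

namespace BanditAlgorithm

variable {ι : Type u}

/-- The sample space: the vector of mean rewards, the coins that determine the rewards (one coin
for the `n`-th sample of each arm, for every `n`), and the seed of the algorithm. -/
abbrev Outcome (A : BanditAlgorithm ι) : Type u := (ι → I) × (ι × ℕ → I) × A.Seed

/-- The joint law: the mean rewards are independent and distributed according to the priors, the
coins are independent and uniform on `[0,1]`, and the seed has its own law; the three are
independent of each other. -/
def law (A : BanditAlgorithm ι) (P : Priors ι) : Measure A.Outcome :=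
  (Measure.infinitePi fun i => (P i : Measure I)).prod
    ((Measure.infinitePi fun _ : ι × ℕ => (volume : Measure I)).prod (A.seedLaw : Measure A.Seed))

/-- The mean reward `μ_i` of arm `i`, as a random variable. -/
def meanReward (A : BanditAlgorithm ι) (i : ι) (ω : A.Outcome) : ℝ := ω.1 i

/-- The reward of the sample of arm `i` with number `n` (counted from `0`); given the mean
rewards, it is a Bernoulli variable with mean `μ_i`, and all these samples are independent. -/
def sample (A : BanditAlgorithm ι) (i : ι) (n : ℕ) (ω : A.Outcome) : Bool :=
  decide (ω.2.1 (i, n) < ω.1 i)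

open Classical in
/-- The history before round `t` (rounds are `0, 1, 2, …`), when the recommendations have been
followed in all past rounds. -/
def history (A : BanditAlgorithm ι) (ω : A.Outcome) : ℕ → History ι
  | 0 => []
  | t + 1 =>
    let h := history A ω t
    let a := A.act h ω.2.2
    (a, A.sample a (h.countP fun p => p.1 = a) ω) :: h

/-- The arm `A_t` that is recommended in round `t`. -/
def recommend (A : BanditAlgorithm ι) (t : ℕ) (ω : A.Outcome) : ι :=
  A.act (A.history ω t) ω.2.2

/-- The algorithm is Bayesian-incentive compatible over the time horizon `T` (finite or infinite):
in each round `t < T`, `E[μ_i - μ_j | A_t = i] ≥ 0` for all arms `i, j` with `Pr[A_t = i] > 0`. -/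
def IsBIC (A : BanditAlgorithm ι) (P : Priors ι) (T : ℕ∞) : Prop :=
  ∀ t : ℕ, (t : ℕ∞) < T → ∀ i j : ι, 0 < A.law P {ω | A.recommend t ω = i} →
    0 ≤ ∫ ω, (A.meanReward i ω - A.meanReward j ω) ∂(A.law P)[|{ω | A.recommend t ω = i}]

open Classical in
/-- An algorithm over the arms in `S`, as an algorithm for the instance with all arms: it
recommends arms in `S` only (the rounds with other arms that the conversion of histories drops
do not occur in its runs). -/
def ofRestricted {S : Set ι} (A : BanditAlgorithm S) : BanditAlgorithm ι where
  Seed := A.Seed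
  seedLaw := A.seedLaw
  act h s :=
    A.act (h.filterMap fun p => if hp : p.1 ∈ S then some (⟨p.1, hp⟩, p.2) else none) s
  measurableSet_act h i := by
    by_cases hi : i ∈ S
    · convert A.measurableSet_act
        (h.filterMap fun p => if hp : p.1 ∈ S then some (⟨p.1, hp⟩, p.2) else none) ⟨i, hi⟩ using 3
      exact ⟨fun h => Subtype.ext h, fun h => congrArg Subtype.val h⟩
    · convert MeasurableSet.empty
      ext s
      simp only [Set.mem_ofPred_eq, Set.mem_empty_iff_false, iff_false]
      rintro rfl
      exact hi (Subtype.property _)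

end BanditAlgorithm

/-- Arm `i` is explorable: some BIC algorithm, over some time horizon, samples arm `i` with
positive probability. -/
def Explorable {ι : Type u} (P : Priors ι) (i : ι) : Prop :=
  ∃ (T : ℕ∞) (A : BanditAlgorithm ι), A.IsBIC P T ∧
    0 < A.law P {ω | ∃ t : ℕ, (t : ℕ∞) < T ∧ A.recommend t ω = i}

/-- A bandit algorithm as a recipe for all problem instances: it may depend on the (finite,
nonempty) set of arms and on the priors. -/
abbrev AlgorithmScheme : Type (u + 1) :=
  (κ : Type u) → [Finite κ] → [Nonempty κ] → Priors κ → BanditAlgorithm κ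

/-- The algorithm is guaranteed to be BIC under pairwise non-dominance: it is BIC for every
instance all of whose arms satisfy pairwise non-dominance. -/
def AlgorithmScheme.GuaranteedBIC (𝒜 : AlgorithmScheme.{u}) (T : ℕ∞) : Prop :=
  ∀ (κ : Type u) [Finite κ] [Nonempty κ] (Q : Priors κ),
    (∀ i, NonDominated Q i) → (𝒜 κ Q).IsBIC Q T

end IncentivizedExploration

end

open IncentivizedExploration

namespace IncentivizedExploration

variable {ι : Type u}

/-! Reward samples are indexed by (arm, number), so a history of positive probability fixes a set of
seeds and finitely many sample values. Given the mean rewards these have a product likelihood, and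
since the arms are independent, integrals against it factor over the arms
(`setIntegral_sampleEvent`, `integral_sub_mul_prod`).

Necessity and restriction. If `μ_j ≥ E[μ_a]` almost surely and `j` is not support-degenerate, then
no data without samples of `a` can make `a` look as good as `j`: `a` stays at its prior mean, while
the posterior mean of `j` stays strictly above it (`integral_sub_mul_neg`,
`setIntegral_recommend_neg`). So the first recommendation of a dominated arm violates BIC.
Conversely, an algorithm confined to `S` never samples a dominated arm `j`, so on every
recommendation event of positive probability `j` remains worse than a dominating arm. That arm can
be taken in `S` (`exists_dominating_nonDominated`), so incentives within `S` imply incentives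
against all arms.

Sufficiency. Let every arm be non-dominated, and order the arms by decreasing prior mean. If the
first `n` samples of all earlier arms are failures, with `n` large, then each earlier arm has
posterior mean below the prior mean of the next arm (`eventually_integral_sub_mul_pow_pos`), and
later arms are no better a priori. This event has positive probability, and on it greedy play
recommends the next arm. Forced exploration is hidden in a uniformly random one of `L` phases; for
large `L` the gain on the failure event outweighs the loss from forced exploration (`staged_isBIC`).
Each arm is then sampled by a deterministic time. -/

/-! ### Likelihoods and the law of finitely many samples -/

/-- The likelihood of the reward `b` of an arm with mean reward `x`. -/
noncomputable def likelihood (b : Bool) (x : I) : ℝ := if b then (x : ℝ) else 1 - x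

lemma continuous_likelihood (b : Bool) : Continuous (likelihood b) := by
  cases b
  · exact continuous_const.sub continuous_subtype_val
  · exact continuous_subtype_val

lemma likelihood_nonneg (b : Bool) (x : I) : 0 ≤ likelihood b x := by
  cases b
  · simpa [likelihood] using x.2.2
  · simpa [likelihood] using x.2.1

lemma likelihood_pos (b : Bool) {x : I} (h0 : (0 : ℝ) < x) (h1 : (x : ℝ) < 1) :
    0 < likelihood b x := by
  cases b
  · simpa [likelihood] using h1
  · simpa [likelihood] using h0

lemma volume_real_coin (b : Bool) (y : I) :
    (volume : Measure I).real {x : I | decide (x < y) = b} = likelihood b y := by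
  cases b
  · have : {x : I | decide (x < y) = false} = Set.Ici y := by ext x; simp
    rw [this, measureReal_def, unitInterval.volume_Ici,
      ENNReal.toReal_ofReal (sub_nonneg.2 y.2.2)]
    simp [likelihood]
  · have : {x : I | decide (x < y) = true} = Set.Iio y := by ext x; simp
    rw [this, measureReal_def, unitInterval.volume_Iio, ENNReal.toReal_ofReal y.2.1]
    simp [likelihood]

lemma measurableSet_coin (b : Bool) (y : I) : MeasurableSet {x : I | decide (x < y) = b} := by
  cases b
  · have : {x : I | decide (x < y) = false} = Set.Ici y := by ext x; simp
    exact this ▸ measurableSet_Ici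
  · have : {x : I | decide (x < y) = true} = Set.Iio y := by ext x; simp
    exact this ▸ measurableSet_Iio

/-- The joint law of the mean rewards. -/
noncomputable abbrev meanLaw (P : Priors ι) : Measure (ι → I) :=
  Measure.infinitePi fun i => (P i : Measure I)

lemma integrable_meanLaw [Finite ι] (P : Priors ι) {φ : (ι → I) → ℝ}
    (hφ : Continuous φ) : Integrable φ (meanLaw P) :=
  hφ.integrable_of_hasCompactSupport (HasCompactSupport.of_compactSpace _)

lemma integrable_prior (p : ProbabilityMeasure I) {φ : I → ℝ} (hφ : Continuous φ) :
    Integrable φ (p : Measure I) :=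
  hφ.integrable_of_hasCompactSupport (HasCompactSupport.of_compactSpace _)

/-- Selecting coordinates injectively pulls a cylinder back to a cylinder. This is what transfers
the means and the coins to the instance with fewer arms. -/
lemma map_comp_infinitePi {α β X : Type*} [MeasurableSpace X] (ν : β → Measure X)
    [∀ b, IsProbabilityMeasure (ν b)] {f : α → β} (hf : Function.Injective f) :
    (Measure.infinitePi ν).map (fun x => x ∘ f) = Measure.infinitePi (fun a => ν (f a)) := by
  classical
  refine Measure.eq_infinitePi _ fun s t ht => ?_
  rw [Measure.map_apply (by fun_prop) (MeasurableSet.pi s.countable_toSet fun i _ => ht i)]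
  -- By injectivity the chosen preimage of `f a` is `a` itself; coordinates outside the image of `s`
  -- carry no constraint.
  have hpre : (fun x : β → X => x ∘ f) ⁻¹' ((s : Set α).pi t) =
      ((s.map ⟨f, hf⟩ : Finset β) : Set β).pi
        (fun b => if h : ∃ a, f a = b then t h.choose else Set.univ) := by
    ext x
    simp only [Set.mem_preimage, Set.mem_pi, Finset.mem_coe, Finset.mem_map,
      Function.Embedding.coeFn_mk, forall_exists_index, and_imp, forall_apply_eq_imp_iff₂,
      Function.comp_apply]
    refine forall₂_congr fun a _ => ?_
    have h : ∃ a', f a' = f a := ⟨a, rfl⟩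
    rw [dif_pos h, hf h.choose_spec]
  rw [hpre, Measure.infinitePi_pi, Finset.prod_map]
  · refine Finset.prod_congr rfl fun a _ => ?_
    have h : ∃ a', f a' = f a := ⟨a, rfl⟩
    simp only [Function.Embedding.coeFn_mk]
    rw [dif_pos h, hf h.choose_spec]
  · intro b _
    split_ifs
    · exact ht _
    · exact MeasurableSet.univ

namespace BanditAlgorithm

instance (A : BanditAlgorithm ι) (P : Priors ι) : IsProbabilityMeasure (A.law P) := by
  unfold law; infer_instance

/-- The event that the seed lies in `D` and that the samples with indices in `C` are given
by `v`. -/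
def sampleEvent (A : BanditAlgorithm ι) (D : Set A.Seed) (C : Finset (ι × ℕ))
    (v : ι × ℕ → Bool) : Set A.Outcome :=
  {ω | ω.2.2 ∈ D ∧ ∀ c ∈ C, A.sample c.1 c.2 ω = v c}

lemma measurable_sample (A : BanditAlgorithm ι) (i : ι) (n : ℕ) : Measurable (A.sample i n) := by
  refine measurable_to_bool ?_
  have : A.sample i n ⁻¹' {true} = {ω | ω.2.1 (i, n) < ω.1 i} := by
    ext ω; simp [sample]
  rw [this]
  exact measurableSet_lt (by fun_prop) (by fun_prop)

lemma measurableSet_sampleEvent (A : BanditAlgorithm ι) {D : Set A.Seed} (hD : MeasurableSet D)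
    (C : Finset (ι × ℕ)) (v : ι × ℕ → Bool) : MeasurableSet (A.sampleEvent D C v) := by
  have : A.sampleEvent D C v =
      (fun ω : A.Outcome => ω.2.2) ⁻¹' D ∩ ⋂ c ∈ C, A.sample c.1 c.2 ⁻¹' {v c} := by
    ext ω; simp [sampleEvent]
  rw [this]
  exact ((by fun_prop : Measurable fun ω : A.Outcome => ω.2.2) hD).inter
    (Finset.measurableSet_biInter _ fun c _ => A.measurable_sample _ _ (measurableSet_singleton _))

lemma integrable_law [Finite ι] (A : BanditAlgorithm ι) (P : Priors ι) {φ : (ι → I) → ℝ}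
    (hφ : Continuous φ) : Integrable (fun ω : A.Outcome => φ ω.1) (A.law P) :=
  (integrable_meanLaw P hφ).comp_fst _

/-- Fubini with the means fixed: the section of the event is a cylinder in the coins times `D`, and
a uniform coin falls below `m i` with probability `m i`. -/
lemma setIntegral_sampleEvent [Finite ι] (A : BanditAlgorithm ι) (P : Priors ι) {D : Set A.Seed}
    (hD : MeasurableSet D) (C : Finset (ι × ℕ)) (v : ι × ℕ → Bool) {φ : (ι → I) → ℝ}
    (hφ : Continuous φ) :
    ∫ ω in A.sampleEvent D C v, φ ω.1 ∂A.law P =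
      (A.seedLaw : Measure A.Seed).real D *
        ∫ m, φ m * ∏ c ∈ C, likelihood (v c) (m c.1) ∂meanLaw P := by
  have hE := A.measurableSet_sampleEvent hD C v
  rw [← integral_indicator hE]
  have hint := (A.integrable_law P hφ).indicator hE
  unfold law at hint ⊢
  rw [integral_prod _ hint, ← integral_const_mul]
  refine integral_congr_ae (Filter.Eventually.of_forall fun m => ?_)
  have hsec : (fun y : (ι × ℕ → I) × A.Seed =>
      (A.sampleEvent D C v).indicator (fun ω => φ ω.1) (m, y)) =
      (((C : Set (ι × ℕ)).pi fun c => {x : I | decide (x < m c.1) = v c}) ×ˢ D).indicator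
        (fun _ => φ m) := by
    ext y
    by_cases h : (m, y) ∈ A.sampleEvent D C v
    · rw [Set.indicator_of_mem h, Set.indicator_of_mem]
      exact ⟨fun c hc => h.2 c hc, h.1⟩
    · rw [Set.indicator_of_notMem h, Set.indicator_of_notMem]
      exact fun h' => h ⟨h'.2, fun c hc => h'.1 c hc⟩
  have hmeas : MeasurableSet ((C : Set (ι × ℕ)).pi fun c => {x : I | decide (x < m c.1) = v c}) :=
    MeasurableSet.pi C.countable_toSet fun c _ => measurableSet_coin _ _
  beta_reduce
  rw [hsec, integral_indicator_const _ (hmeas.prod hD), measureReal_prod_prod, measureReal_def,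
    Measure.infinitePi_pi _ (fun c _ => measurableSet_coin _ _), ENNReal.toReal_prod]
  simp only [← measureReal_def, volume_real_coin, smul_eq_mul]
  ring

end BanditAlgorithm

/-! ### Factorization over independent arms -/

section Product

lemma integral_meanLaw_prod [Fintype ι] (P : Priors ι) (f : ι → I → ℝ) :
    ∫ m, ∏ i, f i (m i) ∂meanLaw P = ∏ i, ∫ x, f i x ∂(P i : Measure I) := by
  rw [meanLaw, Measure.infinitePi_eq_pi, integral_fintype_prod_eq_prod]

variable [DecidableEq ι]

lemma integral_coord_mul_prod [Fintype ι] (P : Priors ι) (ψ : ι → I → ℝ) (b : ι) :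
    ∫ m, (m b : ℝ) * ∏ i, ψ i (m i) ∂meanLaw P =
      (∫ x : I, (x : ℝ) * ψ b x ∂(P b : Measure I)) *
        ∏ i ∈ Finset.univ.erase b, ∫ x, ψ i x ∂(P i : Measure I) := by
  have h := integral_meanLaw_prod P (Function.update ψ b fun x => (x : ℝ) * ψ b x)
  rw [← Finset.mul_prod_erase Finset.univ _ (Finset.mem_univ b), Function.update_self] at h
  have h2 : ∏ i ∈ Finset.univ.erase b, ∫ x, Function.update ψ b (fun x => (x : ℝ) * ψ b x) i x
      ∂(P i : Measure I) = ∏ i ∈ Finset.univ.erase b, ∫ x, ψ i x ∂(P i : Measure I) := by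
    refine Finset.prod_congr rfl fun i hi => ?_
    rw [Function.update_of_ne (Finset.ne_of_mem_erase hi)]
  rw [h2] at h
  rw [← h]
  refine integral_congr_ae (Filter.Eventually.of_forall fun m => ?_)
  beta_reduce
  rw [← Finset.mul_prod_erase Finset.univ (fun i => ψ i (m i)) (Finset.mem_univ b),
    ← Finset.mul_prod_erase Finset.univ _ (Finset.mem_univ b), Function.update_self, mul_assoc]
  congr 2
  refine Finset.prod_congr rfl fun i hi => ?_
  rw [Function.update_of_ne (Finset.ne_of_mem_erase hi)]

/-- The difference of the mean rewards of the arms `a` and `j`, weighted by a product of functions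
of the single mean rewards that does not depend on the mean reward of arm `a`. -/
lemma integral_sub_mul_prod [Fintype ι] (P : Priors ι) {ψ : ι → I → ℝ} (hψ : ∀ i, Continuous (ψ i))
    {a : ι} (j : ι) (ha : ∀ x, ψ a x = 1) :
    ∫ m, ((m a : ℝ) - m j) * ∏ i, ψ i (m i) ∂meanLaw P =
      (∫ x : I, (priorMean P a - x) * ψ j x ∂(P j : Measure I)) *
        ∏ i ∈ Finset.univ.erase j, ∫ x, ψ i x ∂(P i : Measure I) := by
  have hc : ∀ b : ι, Integrable (fun m : ι → I => (m b : ℝ) * ∏ i, ψ i (m i)) (meanLaw P) :=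
    fun b => integrable_meanLaw P (by fun_prop)
  simp only [sub_mul]
  rw [integral_sub (hc a) (hc j), integral_coord_mul_prod, integral_coord_mul_prod,
    integral_sub (integrable_prior _ (by fun_prop)) (integrable_prior _ (by fun_prop)),
    integral_const_mul, sub_mul]
  congr 1
  have hwa : ∫ x, ψ a x ∂(P a : Measure I) = 1 := by simp [ha]
  simp only [ha, mul_one]
  change priorMean P a * _ = _
  rw [mul_assoc, Finset.mul_prod_erase Finset.univ (fun i => ∫ x, ψ i x ∂(P i : Measure I))
    (Finset.mem_univ j), ← Finset.mul_prod_erase Finset.univ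
    (fun i => ∫ x, ψ i x ∂(P i : Measure I)) (Finset.mem_univ a), hwa, one_mul]

/-- The likelihood of the samples with indices in `C` of arm `i`, as a function of the mean
reward of this arm. -/
noncomputable def armLikelihood (C : Finset (ι × ℕ)) (v : ι × ℕ → Bool) (i : ι) (x : I) : ℝ :=
  ∏ c ∈ C with c.1 = i, likelihood (v c) x

lemma continuous_armLikelihood (C : Finset (ι × ℕ)) (v : ι × ℕ → Bool) (i : ι) :
    Continuous (armLikelihood C v i) :=
  continuous_finsetProd _ fun _ _ => continuous_likelihood _

lemma armLikelihood_nonneg (C : Finset (ι × ℕ)) (v : ι × ℕ → Bool) (i : ι) (x : I) :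
    0 ≤ armLikelihood C v i x :=
  Finset.prod_nonneg fun _ _ => likelihood_nonneg _ _

lemma armLikelihood_pos (C : Finset (ι × ℕ)) (v : ι × ℕ → Bool) (i : ι) {x : I}
    (h0 : (0 : ℝ) < x) (h1 : (x : ℝ) < 1) : 0 < armLikelihood C v i x :=
  Finset.prod_pos fun _ _ => likelihood_pos _ h0 h1

lemma armLikelihood_eq_one {C : Finset (ι × ℕ)} (v : ι × ℕ → Bool) {i : ι}
    (h : ∀ c ∈ C, c.1 ≠ i) (x : I) : armLikelihood C v i x = 1 := by
  rw [armLikelihood, Finset.filter_eq_empty_iff.2 fun c hc => h c hc, Finset.prod_empty]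

lemma prod_likelihood [Fintype ι] (C : Finset (ι × ℕ)) (v : ι × ℕ → Bool) (m : ι → I) :
    ∏ c ∈ C, likelihood (v c) (m c.1) = ∏ i, armLikelihood C v i (m i) := by
  rw [← Finset.prod_fiberwise C Prod.fst]
  refine Finset.prod_congr rfl fun i _ => Finset.prod_congr rfl fun c hc => ?_
  rw [(Finset.mem_filter.1 hc).2]

end Product

/-! ### Dominance and prior means -/

lemma priorMean_nonneg (P : Priors ι) (i : ι) : 0 ≤ priorMean P i :=
  integral_nonneg fun x => x.2.1

lemma priorMean_le_one (P : Priors ι) (i : ι) : priorMean P i ≤ 1 := by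
  have h := integral_mono (μ := (P i : Measure I)) (integrable_prior (P i) continuous_subtype_val)
    (integrable_const (1 : ℝ)) fun x => x.2.2
  simpa [priorMean] using h

lemma supportDegenerate_of_ae {P : Priors ι} {i : ι} {c : ℝ} (hc : 0 ≤ c)
    (h : ∀ᵐ x : I ∂(P i : Measure I), (x : ℝ) = c ∨ (x : ℝ) = 1) : SupportDegenerate P i := by
  by_cases h1 : c < 1
  · refine ⟨⟨c, hc, h1.le⟩, ?_, ?_⟩
    · rw [← Subtype.coe_lt_coe]; exact h1
    · filter_upwards [h] with x hx
      exact hx.imp (fun h => Subtype.ext h) (fun h => Subtype.ext h)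
  -- For `c ≥ 1` both alternatives force mean reward `1`, so any point below `1` is a valid witness.
  · refine ⟨0, zero_lt_one, ?_⟩
    filter_upwards [h] with x hx
    refine Or.inr (Subtype.ext (le_antisymm x.2.2 ?_))
    rcases hx with hx | hx
    · rw [hx]; simpa using not_lt.1 h1
    · rw [hx]; simp

lemma ae_le_of_measure_lt_eq_zero {p : ProbabilityMeasure I} {c : ℝ}
    (h : (p : Measure I) {x : I | (x : ℝ) < c} = 0) : ∀ᵐ x : I ∂(p : Measure I), c ≤ (x : ℝ) := by
  rw [ae_iff]; simpa using h

/-- The posterior mean of an arm that dominates arm `a` exceeds the prior mean of arm `a`,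
whatever finite number of samples is observed. -/
lemma integral_sub_mul_neg {P : Priors ι} {j : ι} (hj : ¬ SupportDegenerate P j) {c : ℝ}
    (hc : 0 ≤ c) (hdom : (P j : Measure I) {x : I | (x : ℝ) < c} = 0) {ψ : I → ℝ}
    (hψ : Continuous ψ) (hψ0 : ∀ x, 0 ≤ ψ x)
    (hψ1 : ∀ x : I, c ≤ (x : ℝ) → (x : ℝ) < 1 → 0 < ψ x) :
    ∫ x : I, (c - x) * ψ x ∂(P j : Measure I) < 0 := by
  have hle := ae_le_of_measure_lt_eq_zero hdom
  have hnn : 0 ≤ᵐ[(P j : Measure I)] fun x : I => ((x : ℝ) - c) * ψ x := by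
    filter_upwards [hle] with x hx
    exact mul_nonneg (sub_nonneg.2 hx) (hψ0 x)
  have heq : ∫ x : I, (c - x) * ψ x ∂(P j : Measure I) =
      -∫ x : I, ((x : ℝ) - c) * ψ x ∂(P j : Measure I) := by
    rw [← integral_neg]; congr 1; ext x; ring
  rw [heq, neg_neg_iff_pos]
  -- Equality would make the nonnegative integrand vanish almost surely. As `ψ > 0` on `[c, 1)`, the
  -- mean reward would then be `c` or `1`.
  refine lt_of_le_of_ne (integral_nonneg_of_ae hnn) fun h0 => hj ?_
  have hz := (integral_eq_zero_iff_of_nonneg_ae hnn (integrable_prior _ (by fun_prop))).1 h0.symm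
  refine supportDegenerate_of_ae hc ?_
  filter_upwards [hz, hle] with x hx hcx
  by_cases hx1 : (x : ℝ) < 1
  · rcases mul_eq_zero.1 hx with h | h
    · exact Or.inl (sub_eq_zero.1 h)
    · exact absurd h (hψ1 x hcx hx1).ne'
  · exact Or.inr (le_antisymm x.2.2 (not_lt.1 hx1))

lemma lt_priorMean {P : Priors ι} {j : ι} (hj : ¬ SupportDegenerate P j) {c : ℝ}
    (hc : 0 ≤ c) (hdom : (P j : Measure I) {x : I | (x : ℝ) < c} = 0) : c < priorMean P j := by
  have h := integral_sub_mul_neg hj hc hdom (ψ := fun _ => 1) continuous_const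
    (fun _ => zero_le_one) (fun _ _ _ => one_pos)
  simp only [mul_one] at h
  rw [integral_sub (integrable_const _) (integrable_prior _ continuous_subtype_val)] at h
  simpa [priorMean] using h

lemma priorMean_pos {P : Priors ι} {i : ι} (hi : ¬ SupportDegenerate P i) : 0 < priorMean P i := by
  refine lt_priorMean hi le_rfl ?_
  convert measure_empty (μ := (P i : Measure I))
  ext x
  simpa using x.2.1

lemma not_nonDominated_iff {P : Priors ι} {i : ι} :
    ¬ NonDominated P i ↔ ∃ j, j ≠ i ∧ (P j : Measure I) {x : I | (x : ℝ) < priorMean P i} = 0 := by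
  simp [NonDominated]

/-- Dominating an arm forces a strictly larger prior mean, so an arm of maximal prior mean is not
dominated. -/
lemma nonempty_nonDominatedArms [Finite ι] [Nonempty ι] {P : Priors ι}
    (hP : ∀ i, ¬ SupportDegenerate P i) : Nonempty (nonDominatedArms P) := by
  obtain ⟨i, hi⟩ := Finite.exists_max (priorMean P)
  refine ⟨⟨i, ?_⟩⟩
  by_contra h
  obtain ⟨j, -, hj⟩ := not_nonDominated_iff.1 h
  exact (lt_priorMean (hP j) (priorMean_nonneg P i) hj).not_ge (hi j)

/-- Each dominated arm is dominated by some arm that satisfies pairwise non-dominance. -/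
lemma exists_dominating_nonDominated [Finite ι] {P : Priors ι}
    (hP : ∀ i, ¬ SupportDegenerate P i) {j : ι} (hj : ¬ NonDominated P j) :
    ∃ k, NonDominated P k ∧ k ≠ j ∧
      (P k : Measure I) {x : I | (x : ℝ) < priorMean P j} = 0 := by
  -- Among the arms dominating `j`, take one of largest prior mean. An arm dominating it would also
  -- dominate `j`, with a still larger prior mean.
  obtain ⟨k, ⟨hkj, hk⟩, hmax⟩ := Set.exists_max_image
    {k | k ≠ j ∧ (P k : Measure I) {x : I | (x : ℝ) < priorMean P j} = 0} (priorMean P)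
    (Set.toFinite _) (not_nonDominated_iff.1 hj)
  refine ⟨k, ?_, hkj, hk⟩
  by_contra h
  obtain ⟨l, -, hl⟩ := not_nonDominated_iff.1 h
  have hjk := lt_priorMean (hP k) (priorMean_nonneg P j) hk
  have hkl := lt_priorMean (hP l) (priorMean_nonneg P k) hl
  refine (hmax l ⟨?_, measure_mono_null ?_ hl⟩).not_gt hkl
  · rintro rfl
    exact lt_asymm hjk hkl
  · intro x hx
    exact lt_trans hx hjk

/-! ### Histories as events on seeds and samples -/

namespace BanditAlgorithm

open Classical in
/-- The number of samples of arm `i` in a history. -/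
noncomputable def pulls (h : History ι) (i : ι) : ℕ := h.countP fun p => p.1 = i

open Classical in
lemma pulls_cons (p : ι × Bool) (h : History ι) (i : ι) :
    pulls (p :: h) i = pulls h i + if p.1 = i then 1 else 0 := by
  simp [pulls, List.countP_cons]

lemma pulls_cons_self (a : ι) (b : Bool) (h : History ι) :
    pulls ((a, b) :: h) a = pulls h a + 1 := by
  simp [pulls_cons]

lemma pulls_le_cons (p : ι × Bool) (h : History ι) (i : ι) : pulls h i ≤ pulls (p :: h) i := by
  simp [pulls_cons]

lemma history_succ (A : BanditAlgorithm ι) (ω : A.Outcome) (t : ℕ) :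
    A.history ω (t + 1) = (A.recommend t ω, A.sample (A.recommend t ω)
      (pulls (A.history ω t) (A.recommend t ω)) ω) :: A.history ω t := rfl

lemma length_history (A : BanditAlgorithm ι) (ω : A.Outcome) (t : ℕ) :
    (A.history ω t).length = t := by
  induction t with
  | zero => rfl
  | succ t ih => rw [history_succ, List.length_cons, ih]

/-- The event that a history occurs is described by a set of seeds and by the values of
finitely many samples. -/
lemma exists_history_event (A : BanditAlgorithm ι) (h : History ι) :
    ∃ (D : Set A.Seed) (C : Finset (ι × ℕ)) (v : ι × ℕ → Bool), MeasurableSet D ∧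
      (∀ c ∈ C, c.2 < pulls h c.1) ∧
      {ω | A.history ω h.length = h} = A.sampleEvent D C v := by
  classical
  induction h with
  | nil => exact ⟨Set.univ, ∅, fun _ => true, MeasurableSet.univ, by simp, by
      ext ω; simp [sampleEvent, history]⟩
  | cons p h ih =>
    obtain ⟨a, b⟩ := p
    obtain ⟨D, C, v, hD, hC, hE⟩ := ih
    -- The new sample has a fresh index, so prescribing its value does not interfere with the
    -- earlier ones.
    have hnot : (a, pulls h a) ∉ C := fun hc => lt_irrefl _ (hC _ hc)
    refine ⟨D ∩ {s | A.act h s = a}, insert (a, pulls h a) C,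
      Function.update v (a, pulls h a) b, hD.inter (A.measurableSet_act h a), ?_, ?_⟩
    · intro c hc
      rcases Finset.mem_insert.1 hc with rfl | hc
      · simp [pulls_cons_self]
      · exact (hC c hc).trans_le (pulls_le_cons _ _ _)
    · ext ω
      have hω : A.history ω h.length = h ↔ ω ∈ A.sampleEvent D C v := by rw [← hE]; rfl
      have hupd : (∀ c ∈ C, A.sample c.1 c.2 ω = Function.update v (a, pulls h a) b c) ↔
          ∀ c ∈ C, A.sample c.1 c.2 ω = v c := by
        refine forall₂_congr fun c hc => ?_
        rw [Function.update_of_ne (ne_of_mem_of_not_mem hc hnot)]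
      simp only [Set.mem_ofPred_eq, List.length_cons, history_succ, List.cons.injEq, Prod.mk.injEq]
      simp only [sampleEvent, Finset.forall_mem_insert, Set.mem_ofPred_eq, Set.mem_inter_iff, hupd,
        Function.update_self]
      simp only [sampleEvent, Set.mem_ofPred_eq] at hω
      constructor
      · rintro ⟨⟨h1, h2⟩, h3⟩
        have hr : A.recommend h.length ω = A.act h ω.2.2 := by rw [recommend, h3]
        rw [h3, h1] at h2
        exact ⟨⟨(hω.1 h3).1, hr ▸ h1⟩, h2, (hω.1 h3).2⟩
      · rintro ⟨⟨h1, h2⟩, h3, h4⟩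
        have h5 := hω.2 ⟨h1, h4⟩
        have hr : A.recommend h.length ω = a := by rw [recommend, h5, h2]
        exact ⟨⟨hr, by rw [hr, h5, h3]⟩, h5⟩

lemma measurableSet_history_eq (A : BanditAlgorithm ι) (t : ℕ) (h : History ι) :
    MeasurableSet {ω | A.history ω t = h} := by
  by_cases ht : h.length = t
  · subst ht
    obtain ⟨D, C, v, hD, -, hE⟩ := A.exists_history_event h
    exact hE ▸ A.measurableSet_sampleEvent hD C v
  · convert MeasurableSet.empty
    ext ω
    simp only [Set.mem_ofPred_eq, Set.mem_empty_iff_false, iff_false]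
    rintro rfl
    exact ht (A.length_history ω t)

/-- The event that arm `i` is recommended in round `t` after history `h`. -/
def recommendAfter (A : BanditAlgorithm ι) (t : ℕ) (i : ι) (h : History ι) : Set A.Outcome :=
  {ω | A.history ω t = h ∧ A.act h ω.2.2 = i}

lemma measurableSet_recommendAfter (A : BanditAlgorithm ι) (t : ℕ) (i : ι) (h : History ι) :
    MeasurableSet (A.recommendAfter t i h) :=
  (A.measurableSet_history_eq t h).inter
    ((by fun_prop : Measurable fun ω : A.Outcome => ω.2.2) (A.measurableSet_act h i))

lemma iUnion_recommendAfter (A : BanditAlgorithm ι) (t : ℕ) (i : ι) :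
    ⋃ h, A.recommendAfter t i h = {ω | A.recommend t ω = i} := by
  ext ω; simp [recommendAfter, recommend]

lemma pairwise_disjoint_recommendAfter (A : BanditAlgorithm ι) (t : ℕ) (i : ι) :
    Pairwise (Function.onFun Disjoint (A.recommendAfter t i)) := fun _ _ hne =>
  Set.disjoint_left.2 fun _ h1 h2 => hne (h1.1.symm.trans h2.1)

lemma measurableSet_recommend [Finite ι] (A : BanditAlgorithm ι) (t : ℕ) (i : ι) :
    MeasurableSet {ω | A.recommend t ω = i} := by
  rw [← iUnion_recommendAfter]
  exact MeasurableSet.iUnion fun h => A.measurableSet_recommendAfter t i h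

lemma integrable_meanReward_sub [Finite ι] (A : BanditAlgorithm ι) (P : Priors ι) (i j : ι) :
    Integrable (fun ω => A.meanReward i ω - A.meanReward j ω) (A.law P) :=
  A.integrable_law P (φ := fun m => (m i : ℝ) - m j) (by fun_prop)

/-- Dropping the positive normalization turns the condition into one on set integrals, which are
additive over disjoint pieces of the event. -/
lemma isBIC_iff (A : BanditAlgorithm ι) (P : Priors ι) (T : ℕ∞) :
    A.IsBIC P T ↔ ∀ t : ℕ, (t : ℕ∞) < T → ∀ i j : ι, 0 < A.law P {ω | A.recommend t ω = i} →
      0 ≤ ∫ ω in {ω | A.recommend t ω = i}, (A.meanReward i ω - A.meanReward j ω) ∂A.law P := by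
  refine forall₂_congr fun t _ => forall₂_congr fun i j => forall_congr' fun h => ?_
  rw [ProbabilityTheory.cond, integral_smul_measure, smul_eq_mul]
  refine mul_nonneg_iff_of_pos_left (ENNReal.toReal_pos (ENNReal.inv_ne_zero.2 ?_)
    (ENNReal.inv_ne_top.2 h.ne'))
  exact measure_ne_top _ _

open Classical in
lemma pulls_history (A : BanditAlgorithm ι) (ω : A.Outcome) (t : ℕ) (i : ι) :
    pulls (A.history ω t) i = ((Finset.range t).filter fun s => A.recommend s ω = i).card := by
  induction t with
  | zero => simp [pulls, history]
  | succ t ih =>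
    rw [history_succ, pulls_cons, Finset.range_add_one, Finset.filter_insert, ih]
    split_ifs <;> simp

lemma pulls_history_eq_zero (A : BanditAlgorithm ι) {ω : A.Outcome} {t : ℕ} {i : ι}
    (h : ∀ s < t, A.recommend s ω ≠ i) : pulls (A.history ω t) i = 0 := by
  classical
  rw [pulls_history, Finset.card_eq_zero, Finset.filter_eq_empty_iff]
  exact fun s hs => h s (Finset.mem_range.1 hs)

section Likelihood

variable [Fintype ι] [DecidableEq ι]

lemma setIntegral_meanReward_sub (A : BanditAlgorithm ι) (P : Priors ι) {D : Set A.Seed}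
    (hD : MeasurableSet D) {C : Finset (ι × ℕ)} (v : ι × ℕ → Bool) {a : ι} (j : ι)
    (ha : ∀ c ∈ C, c.1 ≠ a) :
    ∫ ω in A.sampleEvent D C v, (A.meanReward a ω - A.meanReward j ω) ∂A.law P =
      (A.seedLaw : Measure A.Seed).real D *
        ((∫ x : I, (priorMean P a - x) * armLikelihood C v j x ∂(P j : Measure I)) *
          ∏ i ∈ Finset.univ.erase j, ∫ x, armLikelihood C v i x ∂(P i : Measure I)) := by
  rw [← integral_sub_mul_prod P (continuous_armLikelihood C v) j (armLikelihood_eq_one v ha)]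
  simp only [← prod_likelihood]
  exact A.setIntegral_sampleEvent P hD C v (φ := fun m => (m a : ℝ) - m j) (by fun_prop)

lemma law_real_sampleEvent (A : BanditAlgorithm ι) (P : Priors ι) {D : Set A.Seed}
    (hD : MeasurableSet D) (C : Finset (ι × ℕ)) (v : ι × ℕ → Bool) :
    (A.law P).real (A.sampleEvent D C v) = (A.seedLaw : Measure A.Seed).real D *
      ∏ i, ∫ x, armLikelihood C v i x ∂(P i : Measure I) := by
  have h := A.setIntegral_sampleEvent P hD C v (φ := fun _ => 1) continuous_const
  simp only [integral_const, smul_eq_mul, mul_one, one_mul, prod_likelihood,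
    integral_meanLaw_prod] at h
  simpa using h

end Likelihood

/-! ### Dominated arms cannot be explored -/

/-- If arm `j` dominates arm `a`, then arm `a` looks worse than arm `j` as long as it has not been
sampled. -/
lemma setIntegral_recommend_neg [Finite ι] (A : BanditAlgorithm ι) {P : Priors ι} {t : ℕ}
    {i a j : ι} (hj : ¬ SupportDegenerate P j) (ha0 : 0 < priorMean P a)
    (hdom : (P j : Measure I) {x : I | (x : ℝ) < priorMean P a} = 0)
    (hpulls : ∀ᵐ ω ∂A.law P, A.recommend t ω = i → pulls (A.history ω t) a = 0)
    (hpos : 0 < A.law P {ω | A.recommend t ω = i}) :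
    ∫ ω in {ω | A.recommend t ω = i}, (A.meanReward a ω - A.meanReward j ω) ∂A.law P < 0 := by
  classical
  have := Fintype.ofFinite ι
  have hneg : ∀ h, A.law P (A.recommendAfter t i h) ≠ 0 →
      ∫ ω in A.recommendAfter t i h, (A.meanReward a ω - A.meanReward j ω) ∂A.law P < 0 := by
    intro h hh
    -- A history of positive probability is realized by an outcome satisfying the almost sure
    -- hypothesis, so the history itself contains no sample of `a`.
    obtain ⟨ω, ⟨hω1, hω2⟩, hω3⟩ := ((frequently_ae_mem_iff.2 hh).and_eventually hpulls).exists
    have hlen : h.length = t := hω1 ▸ A.length_history ω t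
    have hp : pulls h a = 0 := hω1 ▸ hω3 (by rw [recommend, hω1, hω2])
    obtain ⟨D, C, v, hD, hC, hE⟩ := A.exists_history_event h
    have hE' : A.recommendAfter t i h = A.sampleEvent (D ∩ {s | A.act h s = i}) C v := by
      subst hlen
      ext ω
      have := Set.ext_iff.1 hE ω
      simp only [sampleEvent, Set.mem_ofPred_eq] at this
      simp only [recommendAfter, sampleEvent, Set.mem_ofPred_eq, Set.mem_inter_iff, this]
      tauto
    have hD' := hD.inter (A.measurableSet_act h i)
    have hCa : ∀ c ∈ C, c.1 ≠ a := by
      rintro c hc rfl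
      have := hC c hc
      omega
    rw [hE'] at hh ⊢
    have hreal : (A.law P).real (A.sampleEvent (D ∩ {s | A.act h s = i}) C v) ≠ 0 := by
      rwa [measureReal_ne_zero_iff]
    rw [A.law_real_sampleEvent P hD', ← Finset.mul_prod_erase Finset.univ _ (Finset.mem_univ j)]
      at hreal
    rw [A.setIntegral_meanReward_sub P hD' v j hCa]
    have hs : 0 < (A.seedLaw : Measure A.Seed).real (D ∩ {s | A.act h s = i}) :=
      lt_of_le_of_ne measureReal_nonneg (left_ne_zero_of_mul hreal).symm
    have hw : 0 < ∏ k ∈ Finset.univ.erase j, ∫ x, armLikelihood C v k x ∂(P k : Measure I) :=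
      lt_of_le_of_ne (Finset.prod_nonneg fun k _ => integral_nonneg (armLikelihood_nonneg C v k))
        (right_ne_zero_of_mul (right_ne_zero_of_mul hreal)).symm
    refine mul_neg_of_pos_of_neg hs (mul_neg_of_neg_of_pos ?_ hw)
    -- Since `E[μ_a] > 0`, the relevant interval `[E[μ_a], 1)` avoids both zeros `0` and `1` of the
    -- likelihoods.
    exact integral_sub_mul_neg hj ha0.le hdom (continuous_armLikelihood C v j)
      (armLikelihood_nonneg C v j) fun x hx hx1 => armLikelihood_pos C v j (ha0.trans_le hx) hx1
  rw [← iUnion_recommendAfter] at hpos ⊢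
  obtain ⟨h0, hh0⟩ : ∃ h, A.law P (A.recommendAfter t i h) ≠ 0 := by
    by_contra! hall
    exact hpos.ne' (measure_iUnion_null hall)
  have hsum := hasSum_integral_iUnion (μ := A.law P)
    (f := fun ω => A.meanReward a ω - A.meanReward j ω)
    (fun h => A.measurableSet_recommendAfter t i h) (A.pairwise_disjoint_recommendAfter t i)
    (A.integrable_meanReward_sub P a j).integrableOn
  -- There are countably many histories; null ones contribute `0`, and at least one contributes
  -- strictly negatively.
  refine hasSum_lt (i := h0) (fun h => ?_) (hneg h0 hh0) hsum hasSum_zero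
  by_cases hh : A.law P (A.recommendAfter t i h) = 0
  · rw [setIntegral_measure_zero _ hh]
  · exact (hneg h hh).le

end BanditAlgorithm

/-- At the first round in which arm `i` has positive probability it is almost surely unsampled, so a
dominating arm would look strictly better. -/
lemma Explorable.nonDominated [Finite ι] {P : Priors ι} (hP : ∀ i, ¬ SupportDegenerate P i) {i : ι}
    (hi : Explorable P i) : NonDominated P i := by
  classical
  obtain ⟨T, A, hA, hpos⟩ := hi
  have hex : ∃ t : ℕ, (t : ℕ∞) < T ∧ A.law P {ω | A.recommend t ω = i} ≠ 0 := by
    by_contra! hall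
    refine hpos.ne' ?_
    have : {ω | ∃ t : ℕ, (t : ℕ∞) < T ∧ A.recommend t ω = i} =
        ⋃ t : ℕ, ⋃ _ : (t : ℕ∞) < T, {ω | A.recommend t ω = i} := by
      ext ω; simp
    rw [this]
    exact measure_iUnion_null fun t => measure_iUnion_null fun ht => hall t ht
  obtain ⟨htT, ht⟩ := Nat.find_spec hex
  have hmin := fun s => Nat.find_min hex (m := s)
  generalize Nat.find hex = t at htT ht hmin
  by_contra hnd
  obtain ⟨j, -, hj⟩ := not_nonDominated_iff.1 hnd
  have hnot : ∀ᵐ ω ∂A.law P, ∀ s < t, A.recommend s ω ≠ i := by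
    refine ae_all_iff.2 fun s => ?_
    by_cases hs : s < t
    swap
    · exact Filter.Eventually.of_forall fun _ h => absurd h hs
    have h0 : A.law P {ω | A.recommend s ω = i} = 0 := by
      by_contra h0
      exact hmin s hs ⟨lt_trans (by exact_mod_cast hs) htT, h0⟩
    simpa [ae_iff, hs] using h0
  refine (A.setIntegral_recommend_neg (hP j) (priorMean_pos (hP i)) hj ?_
    (pos_iff_ne_zero.2 ht)).not_ge
    ((A.isBIC_iff P T).1 hA t htT i j (pos_iff_ne_zero.2 ht))
  filter_upwards [hnot] with ω hω _
  exact A.pulls_history_eq_zero hω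

/-! ### Restriction to the arms in `S` -/

namespace BanditAlgorithm

variable {S : Set ι}

/-- The part of an outcome that concerns the arms in `S`. -/
def restrictOutcome (A : BanditAlgorithm S) (ω : (ofRestricted A).Outcome) : A.Outcome :=
  (fun i => ω.1 i, fun c => ω.2.1 (c.1, c.2), ω.2.2)

lemma history_ofRestricted (A : BanditAlgorithm S) (ω : (ofRestricted A).Outcome) (t : ℕ) :
    (ofRestricted A).history ω t =
      (A.history (A.restrictOutcome ω) t).map (Prod.map Subtype.val id) := by
  classical
  have hact : ∀ (h : History S) (s : A.Seed),
      (ofRestricted A).act (h.map (Prod.map Subtype.val id)) s = A.act h s := by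
    intro h s
    simp only [ofRestricted, List.filterMap_map]
    congr 2
    convert List.filterMap_some (l := h) using 2
    ext p
    simp
  have hpulls : ∀ (h : History S) (i : S),
      pulls (h.map (Prod.map Subtype.val id)) (i : ι) = pulls h i := by
    intro h i
    simp only [pulls, List.countP_map]
    refine List.countP_congr fun p _ => ?_
    simp [Subtype.ext_iff]
  induction t with
  | zero => rfl
  | succ t ih =>
    rw [history_succ, history_succ, List.map_cons, ← ih]
    congr 1
    have hr : (ofRestricted A).recommend t ω = A.recommend t (A.restrictOutcome ω) := by
      rw [recommend, ih]; exact hact _ _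
    rw [hr, ih, hpulls]
    rfl

/-- The recommendation in round `t` is the head of the history before round `t + 1`, so the coupling
of histories suffices. -/
lemma recommend_ofRestricted (A : BanditAlgorithm S) (ω : (ofRestricted A).Outcome) (t : ℕ) :
    (ofRestricted A).recommend t ω = A.recommend t (A.restrictOutcome ω) := by
  have h := congrArg List.head? ((A.history_ofRestricted ω (t + 1)))
  rw [history_succ, history_succ] at h
  simpa using congrArg (Option.map Prod.fst) h

lemma measurePreserving_restrictOutcome [Finite ι] (A : BanditAlgorithm S) (P : Priors ι) :
    MeasurePreserving A.restrictOutcome ((ofRestricted A).law P) (A.law (P.restrict S)) := by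
  have h1 : MeasurePreserving (fun m : ι → I => m ∘ (Subtype.val : S → ι)) (meanLaw P)
      (meanLaw (P.restrict S)) :=
    ⟨by fun_prop, map_comp_infinitePi _ Subtype.val_injective⟩
  have h2 : MeasurePreserving
      (fun x : ι × ℕ → I => x ∘ (Prod.map Subtype.val id : S × ℕ → ι × ℕ))
      (Measure.infinitePi fun _ => volume) (Measure.infinitePi fun _ => volume) :=
    ⟨by fun_prop,
      map_comp_infinitePi _ (Subtype.val_injective.prodMap Function.injective_id)⟩
  exact h1.prod (h2.prod (MeasurePreserving.id (A.seedLaw : Measure A.Seed)))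

/-- For `j` outside `S` take a dominating `k` in `S` and split `μ_i - μ_j = (μ_i - μ_k) + (μ_k -
μ_j)`. The first term is handled by BIC within `S`, the second by `j` never being sampled. -/
lemma IsBIC.ofRestricted_nonDominatedArms [Finite ι] {P : Priors ι}
    (hP : ∀ i, ¬ SupportDegenerate P i) {A : BanditAlgorithm (nonDominatedArms P)} {T : ℕ∞}
    (hA : A.IsBIC (P.restrict (nonDominatedArms P)) T) : (ofRestricted A).IsBIC P T := by
  rw [isBIC_iff] at hA ⊢
  intro t ht i j hpos
  have hmp := A.measurePreserving_restrictOutcome P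
  by_cases hi : i ∈ nonDominatedArms P
  swap
  · exfalso
    refine hpos.ne' ?_
    convert measure_empty (μ := (ofRestricted A).law P)
    ext ω
    simp only [Set.mem_ofPred_eq, Set.mem_empty_iff_false, iff_false, recommend_ofRestricted]
    rintro rfl
    exact hi (Subtype.property _)
  have hset : {ω | (ofRestricted A).recommend t ω = i} =
      A.restrictOutcome ⁻¹' {ω | A.recommend t ω = ⟨i, hi⟩} := by
    ext ω
    simp only [Set.mem_ofPred_eq, Set.mem_preimage, recommend_ofRestricted, Subtype.ext_iff]
  have hnn : ∀ k ∈ nonDominatedArms P, 0 ≤ ∫ ω in {ω | (ofRestricted A).recommend t ω = i},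
      ((ofRestricted A).meanReward i ω - (ofRestricted A).meanReward k ω)
        ∂(ofRestricted A).law P := by
    intro k hk
    have hm := A.measurableSet_recommend t ⟨i, hi⟩
    have h := hA t ht ⟨i, hi⟩ ⟨k, hk⟩
      (by rwa [← hmp.measure_preimage hm.nullMeasurableSet, ← hset])
    rw [← hmp.map_eq, setIntegral_map hm _ hmp.measurable.aemeasurable, ← hset] at h
    · exact h
    · rw [hmp.map_eq]
      exact (A.integrable_meanReward_sub _ _ _).aestronglyMeasurable
  by_cases hj : j ∈ nonDominatedArms P
  · exact hnn j hj
  · obtain ⟨k, hk, -, hdom⟩ := exists_dominating_nonDominated hP hj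
    have h := (ofRestricted A).setIntegral_recommend_neg (hP k) (priorMean_pos (hP j)) hdom
      (Filter.Eventually.of_forall fun ω _ => ?_) hpos
    · have h2 := hnn k hk
      have h3 := integral_add (μ := ((ofRestricted A).law P).restrict
        {ω | (ofRestricted A).recommend t ω = i})
        ((ofRestricted A).integrable_meanReward_sub P i j).integrableOn
        ((ofRestricted A).integrable_meanReward_sub P j k).integrableOn
      simp only [sub_add_sub_cancel] at h3
      linarith
    · refine pulls_history_eq_zero _ ?_
      rintro s - rfl
      rw [recommend_ofRestricted] at hj
      exact hj (Subtype.property _)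

end BanditAlgorithm

/-! ### Posterior means after failures, and greedy choices -/

/-- After sufficiently many samples with reward `0`, the posterior mean is smaller than `c`. -/
lemma eventually_integral_sub_mul_pow_pos (p : ProbabilityMeasure I) {c : ℝ} (hc : c ≤ 1)
    (h : 0 < (p : Measure I) {x : I | (x : ℝ) < c}) :
    ∀ᶠ n : ℕ in Filter.atTop, 0 < ∫ x : I, (c - x) * (1 - x) ^ n ∂(p : Measure I) := by
  obtain ⟨a, hac, ha⟩ : ∃ a < c, (p : Measure I) {x : I | (x : ℝ) ≤ a} ≠ 0 := by
    by_contra! hall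
    have : {x : I | (x : ℝ) < c} = ⋃ k : ℕ, {x : I | (x : ℝ) ≤ c - 1 / ((k : ℝ) + 1)} := by
      ext x
      simp only [Set.mem_ofPred_eq, Set.mem_iUnion]
      constructor
      · intro hx
        obtain ⟨k, hk⟩ := exists_nat_one_div_lt (sub_pos.2 hx)
        exact ⟨k, by linarith⟩
      · rintro ⟨k, hk⟩
        have : 0 < 1 / ((k : ℝ) + 1) := Nat.one_div_pos_of_nat
        linarith
    rw [this] at h
    refine h.ne' (measure_iUnion_null fun k => hall _ ?_)
    have : 0 < 1 / ((k : ℝ) + 1) := Nat.one_div_pos_of_nat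
    linarith
  have hq : 0 < (p : Measure I).real {x : I | (x : ℝ) ≤ a} :=
    lt_of_le_of_ne measureReal_nonneg ((measureReal_ne_zero_iff).2 ha).symm
  have hmeas : MeasurableSet {x : I | (x : ℝ) ≤ a} :=
    measurableSet_le measurable_subtype_coe measurable_const
  set δ := (p : Measure I).real {x : I | (x : ℝ) ≤ a} * (c - a) with hδ
  have hδ0 : 0 < δ := mul_pos hq (sub_pos.2 hac)
  have ha1 : 0 < 1 - a := by linarith
  have hlim : Filter.Tendsto (fun n : ℕ => ((1 - c) / (1 - a)) ^ n) Filter.atTop (nhds 0) :=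
    tendsto_pow_atTop_nhds_zero_of_lt_one (div_nonneg (by linarith) ha1.le)
      ((div_lt_one ha1).2 (by linarith))
  filter_upwards [hlim.eventually (gt_mem_nhds hδ0)] with n hn
  rw [div_pow, div_lt_iff₀ (pow_pos ha1 n)] at hn
  -- Keep the gain on `[0, a]`, drop the nonnegative part on `(a, c]`, and bound the loss above `c`
  -- by `(1 - c) ^ n`. The ratio `((1 - c) / (1 - a)) ^ n` tends to `0`, so the gain wins.
  have hpt : ∀ x : I, {x : I | (x : ℝ) ≤ a}.indicator (fun _ => (c - a) * (1 - a) ^ n) x -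
      (1 - c) ^ n ≤ (c - x) * (1 - (x : ℝ)) ^ n := by
    intro x
    have hx1 : 0 ≤ 1 - (x : ℝ) := sub_nonneg.2 x.2.2
    have hcn : 0 ≤ (1 - c) ^ n := pow_nonneg (by linarith) n
    by_cases hxa : (x : ℝ) ≤ a
    · rw [Set.indicator_of_mem (by exact hxa)]
      have : (c - a) * (1 - a) ^ n ≤ (c - x) * (1 - (x : ℝ)) ^ n :=
        mul_le_mul (by linarith) (pow_le_pow_left₀ ha1.le (by linarith) n) (pow_nonneg ha1.le n)
          (by linarith)
      linarith
    · rw [Set.indicator_of_notMem (by exact hxa), zero_sub]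
      by_cases hxc : (x : ℝ) ≤ c
      · have : 0 ≤ (c - x) * (1 - (x : ℝ)) ^ n :=
          mul_nonneg (by linarith) (pow_nonneg hx1 n)
        linarith
      · have h1 : (1 - (x : ℝ)) ^ n ≤ (1 - c) ^ n := pow_le_pow_left₀ hx1 (by linarith) n
        have h2 : (x - c) * (1 - (x : ℝ)) ^ n ≤ 1 * (1 - c) ^ n := by
          refine mul_le_mul ?_ h1 (pow_nonneg hx1 n) zero_le_one
          by_contra! hlt
          have hc0 : c < 0 := by linarith
          have hax : (0 : ℝ) ≤ a := by
            obtain ⟨y, hy⟩ := nonempty_of_measure_ne_zero ha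
            exact le_trans y.2.1 hy
          linarith
        linarith
  have hmono := integral_mono (μ := (p : Measure I))
    (((integrable_const ((c - a) * (1 - a) ^ n)).indicator hmeas).sub
      (integrable_const ((1 - c) ^ n)))
    (integrable_prior p (by fun_prop : Continuous fun x : I => (c - x) * (1 - (x : ℝ)) ^ n)) hpt
  simp only [Pi.sub_apply] at hmono
  rw [integral_sub ((integrable_const _).indicator hmeas) (integrable_const _),
    integral_indicator_const _ hmeas, integral_const] at hmono
  simp only [smul_eq_mul, probReal_univ, one_mul] at hmono
  refine lt_of_lt_of_le ?_ hmono
  rw [hδ] at hn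
  linarith

/-- The expectation of the mean reward of arm `i` on the event that the samples with indices
in `C` are given by `v`. -/
noncomputable def weightedMean (P : Priors ι) (C : Finset (ι × ℕ)) (v : ι × ℕ → Bool) (i : ι) : ℝ :=
  ∫ m, (m i : ℝ) * ∏ c ∈ C, likelihood (v c) (m c.1) ∂meanLaw P

lemma weightedMean_congr (P : Priors ι) {C : Finset (ι × ℕ)} {v v' : ι × ℕ → Bool}
    (h : ∀ c ∈ C, v c = v' c) : weightedMean P C v = weightedMean P C v' := by
  ext i
  unfold weightedMean
  congr 1; ext m; congr 1
  exact Finset.prod_congr rfl fun c hc => by rw [h c hc]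

lemma continuous_prod_likelihood (C : Finset (ι × ℕ)) (v : ι × ℕ → Bool) :
    Continuous fun m : ι → I => ∏ c ∈ C, likelihood (v c) (m c.1) :=
  continuous_finsetProd _ fun _ _ => (continuous_likelihood _).comp (continuous_apply _)

lemma integral_sub_mul_likelihood [Finite ι] (P : Priors ι) (C : Finset (ι × ℕ))
    (v : ι × ℕ → Bool) (i j : ι) :
    ∫ m, ((m i : ℝ) - m j) * ∏ c ∈ C, likelihood (v c) (m c.1) ∂meanLaw P =
      weightedMean P C v i - weightedMean P C v j := by
  have hc := continuous_prod_likelihood C v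
  simp only [sub_mul]
  exact integral_sub (integrable_meanLaw P (by fun_prop)) (integrable_meanLaw P (by fun_prop))

open Classical in
/-- A maximizer of `W`; it is `a` if `a` is among the maximizers. -/
noncomputable def bestArm [Finite ι] [Nonempty ι] (W : ι → ℝ) (a : ι) : ι :=
  if ∀ j, W j ≤ W a then a else (Finite.exists_max W).choose

/-- An arm with the best posterior mean given the samples with indices in `C`; it is arm `a` if
this arm is among the best. -/
noncomputable def greedyArm [Finite ι] [Nonempty ι] (P : Priors ι) (C : Finset (ι × ℕ))
    (v : ι × ℕ → Bool) (a : ι) : ι :=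
  bestArm (weightedMean P C v) a

section Greedy

variable [Finite ι] [Nonempty ι]

lemma le_bestArm (W : ι → ℝ) (a j : ι) : W j ≤ W (bestArm W a) := by
  unfold bestArm
  split_ifs with h
  · exact h j
  · exact (Finite.exists_max W).choose_spec j

lemma weightedMean_le_greedyArm (P : Priors ι) (C : Finset (ι × ℕ)) (v : ι × ℕ → Bool)
    (a j : ι) : weightedMean P C v j ≤ weightedMean P C v (greedyArm P C v a) :=
  le_bestArm _ a j

lemma greedyArm_eq_self (P : Priors ι) {C : Finset (ι × ℕ)} {v : ι × ℕ → Bool} {a : ι}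
    (h : ∀ j, weightedMean P C v j ≤ weightedMean P C v a) : greedyArm P C v a = a :=
  if_pos h

lemma greedyArm_congr (P : Priors ι) {C : Finset (ι × ℕ)} {v v' : ι × ℕ → Bool}
    (h : ∀ c ∈ C, v c = v' c) (a : ι) : greedyArm P C v a = greedyArm P C v' a := by
  rw [greedyArm, greedyArm, weightedMean_congr P h]

end Greedy

namespace BanditAlgorithm

/-- The integral over an event that is determined by the seed and finitely many samples, if it is
nonnegative for all possible values of the samples. -/
lemma le_setIntegral_samples [Finite ι] (A : BanditAlgorithm ι) (P : Priors ι) {D : Set A.Seed}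
    (hD : MeasurableSet D) {C : Finset (ι × ℕ)} {G : (ι × ℕ → Bool) → Prop}
    (hG : ∀ v v', (∀ c ∈ C, v c = v' c) → (G v ↔ G v')) {φ : (ι → I) → ℝ} (hφ : Continuous φ)
    (hφG : ∀ v, G v → 0 ≤ ∫ m, φ m * ∏ c ∈ C, likelihood (v c) (m c.1) ∂meanLaw P) :
    0 ≤ ∫ ω in {ω : A.Outcome | ω.2.2 ∈ D ∧ G fun c => A.sample c.1 c.2 ω}, φ ω.1 ∂A.law P ∧
    ∀ v, G v → (A.seedLaw : Measure A.Seed).real D *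
        ∫ m, φ m * ∏ c ∈ C, likelihood (v c) (m c.1) ∂meanLaw P ≤
      ∫ ω in {ω : A.Outcome | ω.2.2 ∈ D ∧ G fun c => A.sample c.1 c.2 ω}, φ ω.1 ∂A.law P := by
  classical
  -- Extends values on `C` to all indices; the default `true` is harmless because `G` depends only
  -- on `C`.
  let e : (C → Bool) → ι × ℕ → Bool := fun d c => if hc : c ∈ C then d ⟨c, hc⟩ else true
  have he : ∀ (v : ι × ℕ → Bool), ∀ c ∈ C, e (fun c => v c) c = v c := fun v c hc => dif_pos hc
  have hset : {ω : A.Outcome | ω.2.2 ∈ D ∧ G fun c => A.sample c.1 c.2 ω} =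
      ⋃ d : {d : C → Bool // G (e d)}, A.sampleEvent D C (e d) := by
    ext ω
    simp only [Set.mem_ofPred_eq, Set.mem_iUnion, sampleEvent, Subtype.exists]
    constructor
    · rintro ⟨h1, h2⟩
      refine ⟨fun c => A.sample c.1.1 c.1.2 ω, ?_, h1, fun c hc => ?_⟩
      · exact (hG _ _ (he fun c => A.sample c.1 c.2 ω)).2 h2
      · exact (he (fun c => A.sample c.1 c.2 ω) c hc).symm
    · rintro ⟨d, hd, h1, h2⟩
      exact ⟨h1, (hG _ _ h2).2 hd⟩
  have hint : ∫ ω in {ω : A.Outcome | ω.2.2 ∈ D ∧ G fun c => A.sample c.1 c.2 ω},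
      φ ω.1 ∂A.law P = ∑ d : {d : C → Bool // G (e d)}, (A.seedLaw : Measure A.Seed).real D *
        ∫ m, φ m * ∏ c ∈ C, likelihood (e d c) (m c.1) ∂meanLaw P := by
    rw [hset, integral_iUnion_fintype]
    · exact Finset.sum_congr rfl fun d _ => A.setIntegral_sampleEvent P hD C _ hφ
    · exact fun d => A.measurableSet_sampleEvent hD C _
    · intro d d' hne
      refine Set.disjoint_left.2 fun ω h1 h2 => hne (Subtype.ext (funext fun c => ?_))
      have h3 := (h1.2 c c.2).symm.trans (h2.2 c c.2)
      simpa [e] using h3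
    · exact fun d => (A.integrable_law P hφ).integrableOn
  have hterm : ∀ d : {d : C → Bool // G (e d)}, 0 ≤ (A.seedLaw : Measure A.Seed).real D *
      ∫ m, φ m * ∏ c ∈ C, likelihood (e d c) (m c.1) ∂meanLaw P :=
    fun d => mul_nonneg measureReal_nonneg (hφG _ d.2)
  rw [hint]
  refine ⟨Finset.sum_nonneg fun d _ => hterm d, fun v hv => ?_⟩
  have hle := Finset.single_le_sum (fun d _ => hterm d)
    (Finset.mem_univ (⟨fun c => v c, (hG _ _ (he v)).2 hv⟩ : {d : C → Bool // G (e d)}))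
  refine le_trans (le_of_eq ?_) hle
  congr 2; ext m; congr 1
  exact Finset.prod_congr rfl fun c hc => by rw [he v c hc]

open Classical in
/-- The reward of the sample with index `c`, as recorded in a history. -/
noncomputable def recordedSample : History ι → ι × ℕ → Bool
  | [], _ => true
  | p :: h, c => if p.1 = c.1 ∧ pulls h c.1 = c.2 then p.2 else recordedSample h c

/-- With the most recent round first, the number of pulls in the tail is the index of the head's
sample. The bound on `c.2` keeps the default value from being reached. -/
lemma recordedSample_history (A : BanditAlgorithm ι) (ω : A.Outcome) {t : ℕ} {c : ι × ℕ}
    (hc : c.2 < pulls (A.history ω t) c.1) :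
    recordedSample (A.history ω t) c = A.sample c.1 c.2 ω := by
  induction t with
  | zero => simp [pulls, history] at hc
  | succ t ih =>
    rw [history_succ, pulls_cons] at hc
    rw [history_succ, recordedSample]
    split_ifs with h
    · obtain ⟨h1, h2⟩ := h
      simp only at h1 ⊢
      rw [h1, h2]
    · refine ih ?_
      simp only [not_and] at h
      split_ifs at hc with h1
      · have := h h1
        omega
      · omega

end BanditAlgorithm

/-! ### The advantage of the next arm after failures -/

open Classical in
/-- The indices of the first `n` samples of the arms `τ 0, …, τ (k - 1)`. -/
noncomputable def initialSamples (τ : ℕ → ι) (n k : ℕ) : Finset (ι × ℕ) :=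
  (Finset.range k).image τ ×ˢ Finset.range n

lemma mem_initialSamples {τ : ℕ → ι} {n k : ℕ} {c : ι × ℕ} :
    c ∈ initialSamples τ n k ↔ (∃ j < k, τ j = c.1) ∧ c.2 < n := by
  simp [initialSamples, Finset.mem_product]

/-- The likelihood of failures can vanish only at mean reward `1`, and a mean reward almost surely
`1` is support-degenerate. -/
lemma integral_armLikelihood_false_pos [DecidableEq ι] {P : Priors ι} {i : ι}
    (hi : ¬ SupportDegenerate P i) (C : Finset (ι × ℕ)) :
    0 < ∫ x, armLikelihood C (fun _ => false) i x ∂(P i : Measure I) := by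
  refine lt_of_le_of_ne (integral_nonneg (armLikelihood_nonneg _ _ _)) fun h0 => hi ?_
  have hz := (integral_eq_zero_iff_of_nonneg (armLikelihood_nonneg C (fun _ => false) i)
    (integrable_prior _ (continuous_armLikelihood _ _ _))).1 h0.symm
  refine supportDegenerate_of_ae zero_le_one ?_
  filter_upwards [hz] with x hx
  obtain ⟨c, -, hc⟩ := Finset.prod_eq_zero_iff.1 hx
  exact Or.inr (sub_eq_zero.1 (by simpa [likelihood] using hc)).symm

lemma armLikelihood_initialSamples_false [DecidableEq ι] {τ : ℕ → ι} {n k : ℕ} {i : ι}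
    (hi : ∃ j < k, τ j = i) (x : I) :
    armLikelihood (initialSamples τ n k) (fun _ => false) i x = (1 - (x : ℝ)) ^ n := by
  have : (initialSamples τ n k).filter (fun c => c.1 = i) = {i} ×ˢ Finset.range n := by
    ext c
    simp only [Finset.mem_filter, mem_initialSamples, Finset.mem_product, Finset.mem_singleton,
      Finset.mem_range]
    constructor
    · rintro ⟨⟨-, h1⟩, h2⟩
      exact ⟨h2, h1⟩
    · rintro ⟨h2, h1⟩
      exact ⟨⟨h2 ▸ hi, h1⟩, h2⟩
  rw [armLikelihood, this]
  simp [likelihood]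

/-- The advantage of arm `τ k` over arm `j` on the event that the first `n` samples of the arms
`τ 0, …, τ (k - 1)` all have reward `0`. -/
noncomputable def failureGap (P : Priors ι) (τ : ℕ → ι) (n k : ℕ) (j : ι) : ℝ :=
  weightedMean P (initialSamples τ n k) (fun _ => false) (τ k) -
    weightedMean P (initialSamples τ n k) (fun _ => false) j

section FailureGap

variable [Finite ι] {P : Priors ι} {τ : ℕ → ι} {n k K : ℕ}

open Classical in
-- Arm `τ k` is unsampled and enters through its prior mean; the positive factor `w` collects the
-- failure likelihoods of the arms other than `j`. Only the one-arm integral for `j` decides the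
-- sign.
lemma exists_failureGap_eq (hP : ∀ i, ¬ SupportDegenerate P i) (hinj : Set.InjOn τ (Set.Iio K))
    (hk : k < K) (j : ι) : ∃ w > 0, failureGap P τ n k j =
      (∫ x : I, (priorMean P (τ k) - x) * (if ∃ j' < k, τ j' = j then (1 - (x : ℝ)) ^ n else 1)
        ∂(P j : Measure I)) * w := by
  have := Fintype.ofFinite ι
  refine ⟨_, Finset.prod_pos fun i (_ : i ∈ Finset.univ.erase j) =>
    integral_armLikelihood_false_pos (hP i) (initialSamples τ n k), ?_⟩
  rw [failureGap, ← integral_sub_mul_likelihood]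
  simp only [prod_likelihood]
  have hnot : ∀ c ∈ initialSamples τ n k, c.1 ≠ τ k := by
    rintro c hc heq
    obtain ⟨⟨j', hj', hj''⟩, -⟩ := mem_initialSamples.1 hc
    exact hj'.ne (hinj (Set.mem_Iio.2 (hj'.trans hk)) (Set.mem_Iio.2 hk) (hj''.trans heq))
  rw [integral_sub_mul_prod P (continuous_armLikelihood _ _) j (armLikelihood_eq_one _ hnot)]
  congr 2
  ext x
  congr 1
  split_ifs with h
  · exact armLikelihood_initialSamples_false h x
  · refine armLikelihood_eq_one _ (fun c hc hcj => h ?_) x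
    exact hcj ▸ (mem_initialSamples.1 hc).1

lemma failureGap_pos (hP : ∀ i, ¬ SupportDegenerate P i) (hinj : Set.InjOn τ (Set.Iio K))
    (hn : ∀ a j : ι, j ≠ a →
      0 < ∫ x : I, (priorMean P a - x) * (1 - (x : ℝ)) ^ n ∂(P j : Measure I))
    (hk : k < K) {j : ι} (hj : ∃ j' < k, τ j' = j) : 0 < failureGap P τ n k j := by
  obtain ⟨w, hw, h⟩ := exists_failureGap_eq (n := n) hP hinj hk j
  rw [h]
  simp only [if_pos hj]
  obtain ⟨j', hj', rfl⟩ := hj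
  exact mul_pos (hn _ _ fun heq =>
    hj'.ne (hinj (Set.mem_Iio.2 (hj'.trans hk)) (Set.mem_Iio.2 hk) heq)) hw

lemma failureGap_nonneg (hP : ∀ i, ¬ SupportDegenerate P i) (hinj : Set.InjOn τ (Set.Iio K))
    (hk : k < K) {j : ι} (hj : ¬ ∃ j' < k, τ j' = j) (hle : priorMean P j ≤ priorMean P (τ k)) :
    0 ≤ failureGap P τ n k j := by
  obtain ⟨w, hw, h⟩ := exists_failureGap_eq (n := n) hP hinj hk j
  rw [h]
  simp only [if_neg hj, mul_one]
  refine mul_nonneg ?_ hw.le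
  rw [integral_sub (integrable_const _) (integrable_prior _ continuous_subtype_val)]
  simpa [priorMean] using hle

end FailureGap

/-! ### Staged exploration with a hidden exploration phase -/

namespace BanditAlgorithm

/-- The recommendation of the algorithm `stagedExploration`. -/
noncomputable def stagedAct [Finite ι] [Nonempty ι] (P : Priors ι) (τ : ℕ → ι) (K n L : ℕ)
    (h : History ι) (s : Fin L) : ι :=
  if h.length / (n * L) < K ∧ h.length / n % L = s then τ (h.length / (n * L))
  else greedyArm P (initialSamples τ n (h.length / (n * L))) (recordedSample h)
    (τ (h.length / (n * L)))

/-- The algorithm proceeds in stages of `L` phases with `n` rounds each. In stage `k < K`, arm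
`τ k` is recommended in the phase that is given by the random seed. In all other rounds, the
recommendation is greedy with respect to the first `n` samples of the arms `τ 0, …, τ (k - 1)`. -/
noncomputable def stagedExploration [Finite ι] [Nonempty ι] (P : Priors ι) (τ : ℕ → ι)
    (K n L : ℕ) [NeZero L] : BanditAlgorithm ι where
  Seed := Fin L
  seedLaw := ⟨uniformOn Set.univ, inferInstance⟩
  act := stagedAct P τ K n L
  measurableSet_act _ _ := MeasurableSet.of_discrete

lemma uniformOn_fin_real_singleton (l : Fin L) :
    (uniformOn (Set.univ : Set (Fin L))).real {l} = 1 / L := by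
  rw [measureReal_def, uniformOn_univ]
  simp

/-- Every phase of stage `j` has ended once round `t` belongs to a later stage. -/
lemma phase_lt {n L j t : ℕ} (s : Fin L) (hjt : j < t / (n * L)) {r : ℕ} (hr : r < n) :
    (j * L + s.val) * n + r < t := by
  have h1 : (j + 1) * (n * L) ≤ t := le_trans (Nat.mul_le_mul_right _ hjt) (Nat.div_mul_le_self _ _)
  have h2 : (j * L + s.val + 1) * n ≤ (j + 1) * L * n :=
    Nat.mul_le_mul_right _ (by have := s.isLt; rw [add_mul, one_mul]; omega)
  have h3 : (j + 1) * L * n = (j + 1) * (n * L) := by ring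
  rw [add_mul _ 1 n, one_mul] at h2
  omega

section Staged

variable [Finite ι] [Nonempty ι] {P : Priors ι} {τ : ℕ → ι} {K n L : ℕ} [NeZero L]

lemma recommend_staged (ω : (stagedExploration P τ K n L).Outcome) (t : ℕ) :
    (stagedExploration P τ K n L).recommend t ω =
      if t / (n * L) < K ∧ t / n % L = (ω.2.2 : Fin L).val then τ (t / (n * L))
      else greedyArm P (initialSamples τ n (t / (n * L)))
        (recordedSample ((stagedExploration P τ K n L).history ω t)) (τ (t / (n * L))) := by
  have h : (stagedExploration P τ K n L).recommend t ω =
    stagedAct P τ K n L ((stagedExploration P τ K n L).history ω t) ω.2.2 := rfl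
  rw [h]
  simp only [stagedAct, length_history]

lemma recommend_staged_phase (hn : 0 < n) (ω : (stagedExploration P τ K n L).Outcome) {j r : ℕ}
    (hj : j < K) (hr : r < n) :
    (stagedExploration P τ K n L).recommend ((j * L + (ω.2.2 : Fin L).val) * n + r) ω = τ j := by
  have hs := (ω.2.2 : Fin L).isLt
  have h1 : ((j * L + (ω.2.2 : Fin L).val) * n + r) / n = j * L + (ω.2.2 : Fin L).val := by
    rw [mul_comm, Nat.mul_add_div hn, Nat.div_eq_of_lt hr, add_zero]
  have h2 : ((j * L + (ω.2.2 : Fin L).val) * n + r) / (n * L) = j := by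
    rw [← Nat.div_div_eq_div_mul, h1, mul_comm, Nat.mul_add_div (NeZero.pos L),
      Nat.div_eq_of_lt hs, add_zero]
  have h3 : (j * L + (ω.2.2 : Fin L).val) % L = (ω.2.2 : Fin L).val := by
    rw [mul_comm, Nat.mul_add_mod, Nat.mod_eq_of_lt hs]
  rw [recommend_staged, h2, h1, h3, if_pos ⟨hj, rfl⟩]

lemma le_pulls_staged (hn : 0 < n) (ω : (stagedExploration P τ K n L).Outcome) {j t : ℕ}
    (hj : j < K) (hjt : j < t / (n * L)) :
    n ≤ pulls ((stagedExploration P τ K n L).history ω t) (τ j) := by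
  classical
  rw [pulls_history]
  have h := Finset.card_le_card_of_injOn (s := Finset.range n)
    (t := (Finset.range t).filter fun s => (stagedExploration P τ K n L).recommend s ω = τ j)
    (fun r => (j * L + (ω.2.2 : Fin L).val) * n + r) ?_ (fun _ _ _ _ h => Nat.add_left_cancel h)
  · rw [Finset.card_range] at h
    convert h
  · intro r hr
    have hr' : r < n := Finset.mem_range.1 hr
    exact Finset.mem_coe.2 (Finset.mem_filter.2
      ⟨Finset.mem_range.2 (phase_lt _ hjt hr'), recommend_staged_phase hn ω hj hr'⟩)

/-- The samples used by the greedy choice are on record by stage `k`, whichever phases explored. The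
choice is thus a function of samples alone, and these are independent of the seed. -/
lemma recommend_staged_samples (hn : 0 < n) (hτ : ∀ i, ∃ j < K, τ j = i)
    (ω : (stagedExploration P τ K n L).Outcome) (t : ℕ) :
    (stagedExploration P τ K n L).recommend t ω =
      if t / (n * L) < K ∧ t / n % L = (ω.2.2 : Fin L).val then τ (t / (n * L))
      else greedyArm P (initialSamples τ n (t / (n * L)))
        (fun c => (stagedExploration P τ K n L).sample c.1 c.2 ω) (τ (t / (n * L))) := by
  rw [recommend_staged]
  congr 1
  refine greedyArm_congr P (fun c hc => recordedSample_history _ _ ?_) _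
  obtain ⟨⟨j, hj, hjc⟩, hcn⟩ := mem_initialSamples.1 hc
  rw [← hjc]
  by_cases hjK : j < K
  · exact hcn.trans_le (le_pulls_staged hn ω hjK hj)
  · obtain ⟨j', hj', heq⟩ := hτ (τ j)
    rw [← heq]
    exact hcn.trans_le (le_pulls_staged hn ω hj' (by omega))

lemma staged_isBIC (hP : ∀ i, ¬ SupportDegenerate P i) (hn0 : 0 < n)
    (hτ : ∀ i, ∃ j < K, τ j = i) (hinj : Set.InjOn τ (Set.Iio K))
    (hanti : ∀ j k, j ≤ k → k < K → priorMean P (τ k) ≤ priorMean P (τ j))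
    (hn : ∀ a j : ι, j ≠ a →
      0 < ∫ x : I, (priorMean P a - x) * (1 - (x : ℝ)) ^ n ∂(P j : Measure I))
    (hL : ∀ k < K, ∀ j, 0 < failureGap P τ n k j → 1 ≤ (L - 1 : ℝ) * failureGap P τ n k j) :
    (stagedExploration P τ K n L).IsBIC P ⊤ := by
  rw [isBIC_iff]
  intro t _ i j _
  set A := stagedExploration P τ K n L with hA
  set k := t / (n * L) with hk
  set C := initialSamples τ n k with hC
  have hφ : Continuous fun m : ι → I => (m i : ℝ) - m j := by fun_prop
  have hG : ∀ v v' : ι × ℕ → Bool, (∀ c ∈ C, v c = v' c) →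
      (greedyArm P C v (τ k) = i ↔ greedyArm P C v' (τ k) = i) := fun v v' h => by
    rw [greedyArm_congr P h]
  have hφG : ∀ v : ι × ℕ → Bool, greedyArm P C v (τ k) = i →
      0 ≤ ∫ m, ((m i : ℝ) - m j) * ∏ c ∈ C, likelihood (v c) (m c.1) ∂meanLaw P := by
    rintro v rfl
    rw [integral_sub_mul_likelihood, sub_nonneg]
    exact weightedMean_le_greedyArm P C v _ _
  have hgreedy := fun (D : Set A.Seed) (hD : MeasurableSet D) =>
    A.le_setIntegral_samples P hD hG hφ hφG
  -- `D` is the event, of probability `1 / L`, that the phase containing round `t` is the one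
  -- selected for exploration.
  obtain ⟨D, hD, hDreal, hrec1, hrec2⟩ : ∃ D : Set A.Seed, MeasurableSet D ∧
      (A.seedLaw : Measure A.Seed).real D = 1 / L ∧
      (∀ ω : A.Outcome, k < K → ω.2.2 ∈ D → A.recommend t ω = τ k) ∧
      ∀ ω : A.Outcome, ¬ (k < K ∧ ω.2.2 ∈ D) →
        A.recommend t ω = greedyArm P C (fun c => A.sample c.1 c.2 ω) (τ k) := by
    let l : Fin L := ⟨t / n % L, Nat.mod_lt _ (NeZero.pos L)⟩
    have hseed : ∀ s : Fin L, t / n % L = s.val ↔ s ∈ ({l} : Set (Fin L)) := fun s => by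
      rw [Set.mem_singleton_iff, Fin.ext_iff, eq_comm]
    refine ⟨({l} : Set (Fin L)), MeasurableSet.of_discrete (α := Fin L),
      uniformOn_fin_real_singleton l, fun ω hkK hω => ?_, fun ω hω => ?_⟩
    · exact (recommend_staged_samples hn0 hτ ω t).trans (if_pos ⟨hkK, (hseed _).2 hω⟩)
    · exact (recommend_staged_samples hn0 hτ ω t).trans
        (if_neg fun h => hω ⟨h.1, (hseed _).1 h.2⟩)
  change 0 ≤ ∫ ω in {ω | A.recommend t ω = i}, ((ω.1 i : ℝ) - ω.1 j) ∂A.law P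
  by_cases hkK : k < K
  swap
  · have hset : {ω | A.recommend t ω = i} = {ω : A.Outcome | ω.2.2 ∈ (Set.univ : Set A.Seed) ∧
        greedyArm P C (fun c => A.sample c.1 c.2 ω) (τ k) = i} := by
      ext ω
      simp [hrec2 ω fun h => hkK h.1]
    rw [hset]
    exact (hgreedy _ MeasurableSet.univ).1
  by_cases hi : i = τ k
  swap
  · have hset : {ω | A.recommend t ω = i} = {ω : A.Outcome | ω.2.2 ∈ Dᶜ ∧
        greedyArm P C (fun c => A.sample c.1 c.2 ω) (τ k) = i} := by
      ext ω
      by_cases h : ω.2.2 ∈ D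
      · simp [hrec1 ω hkK h, h, Ne.symm hi]
      · simp [hrec2 ω fun h' => h h'.2, h]
    rw [hset]
    exact (hgreedy _ hD.compl).1
  -- Arm `τ k` is recommended either by forced exploration, where only the prior is known, or by the
  -- greedy choice outside `D`.
  have hset : {ω | A.recommend t ω = i} = A.sampleEvent D ∅ (fun _ => true) ∪
      {ω : A.Outcome | ω.2.2 ∈ Dᶜ ∧ greedyArm P C (fun c => A.sample c.1 c.2 ω) (τ k) = i} := by
    ext ω
    by_cases h : ω.2.2 ∈ D
    · simp [sampleEvent, hrec1 ω hkK h, h, hi]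
    · simp [sampleEvent, hrec2 ω fun h' => h h'.2, h]
  have hdisj : Disjoint (A.sampleEvent D ∅ (fun _ => true))
      {ω : A.Outcome | ω.2.2 ∈ Dᶜ ∧ greedyArm P C (fun c => A.sample c.1 c.2 ω) (τ k) = i} :=
    Set.disjoint_left.2 fun ω h1 h2 => h2.1 h1.1
  have hsplit := setIntegral_union (μ := A.law P) (f := fun ω => (ω.1 i : ℝ) - ω.1 j) hdisj.symm
    (A.measurableSet_sampleEvent hD ∅ (fun _ => true))
    (A.integrable_meanReward_sub P i j).integrableOn
    (A.integrable_meanReward_sub P i j).integrableOn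
  rw [Set.union_comm, add_comm] at hsplit
  rw [hset, hsplit, A.setIntegral_sampleEvent P hD ∅ (fun _ => true) hφ]
  -- Against explored arms the gap is positive and `L` compensates a prior loss of at most `1`;
  -- against the others the ordering makes both terms nonnegative.
  have hgap : ∀ j, (0 ≤ failureGap P τ n k j) ∧
      0 ≤ (L - 1 : ℝ) * failureGap P τ n k j + (priorMean P (τ k) - priorMean P j) := by
    intro j
    by_cases hj : ∃ j' < k, τ j' = j
    · have hpos := failureGap_pos hP hinj hn hkK hj
      have := hL k hkK j hpos
      have := priorMean_nonneg P (τ k)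
      have := priorMean_le_one P j
      exact ⟨hpos.le, by linarith⟩
    · have hle : priorMean P j ≤ priorMean P (τ k) := by
        obtain ⟨j', hj', rfl⟩ := hτ j
        exact hanti _ _ (not_lt.1 fun h => hj ⟨j', h, rfl⟩) hj'
      have hnn := failureGap_nonneg (n := n) hP hinj hkK hj hle
      have hL1 : (1 : ℝ) ≤ L := by exact_mod_cast NeZero.one_le
      exact ⟨hnn, add_nonneg (mul_nonneg (by linarith) hnn) (by linarith)⟩
  -- Ties must favour `τ k` here, since the gap may be `0`, in particular for `j = τ k`. All other
  -- greedy contributions are nonnegative, so the failure event bounds the greedy integral from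
  -- below.
  have hfail : greedyArm P C (fun _ => false) (τ k) = i := by
    rw [hi]
    exact greedyArm_eq_self P fun j => sub_nonneg.1 (hgap j).1
  have hge := (hgreedy _ hD.compl).2 _ hfail
  rw [integral_sub_mul_likelihood, hi] at hge
  change _ * failureGap P τ n k j ≤ _ at hge
  have hprior : ∫ m, ((m i : ℝ) - m j) * ∏ c ∈ (∅ : Finset (ι × ℕ)), likelihood true (m c.1)
      ∂meanLaw P = priorMean P (τ k) - priorMean P j := by
    have hpm : ∀ b : ι, ∫ m, (m b : ℝ) ∂meanLaw P = priorMean P b := by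
      intro b
      have hmp := measurePreserving_eval_infinitePi (fun i => (P i : Measure I)) b
      rw [priorMean, ← hmp.map_eq, integral_map hmp.measurable.aemeasurable
        continuous_subtype_val.aestronglyMeasurable]
    simp only [Finset.prod_empty, mul_one]
    rw [integral_sub (integrable_meanLaw P (by fun_prop)) (integrable_meanLaw P (by fun_prop)),
      hpm, hpm, hi]
  rw [hprior]
  have hlc : (A.seedLaw : Measure A.Seed).real Dᶜ = 1 - 1 / L := by
    rw [measureReal_compl hD, hDreal, probReal_univ]
  rw [hlc] at hge
  rw [hDreal]
  subst hi
  refine le_trans ?_ (add_le_add_right hge _)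
  have hL0 : (0 : ℝ) < L := by exact_mod_cast NeZero.pos L
  have : 1 / (L : ℝ) * (priorMean P (τ k) - priorMean P j) +
      (1 - 1 / (L : ℝ)) * failureGap P τ n k j =
      1 / L * ((L - 1 : ℝ) * failureGap P τ n k j + (priorMean P (τ k) - priorMean P j)) := by
    field_simp
    ring
  rw [this]
  exact mul_nonneg (by positivity) (hgap j).2

end Staged

/-- If all arms satisfy pairwise non-dominance, then a BIC algorithm explores all of them within a
bounded number of rounds. -/
lemma exists_isBIC_explores_all [Finite ι] [Nonempty ι] {P : Priors ι}
    (hP : ∀ i, ¬ SupportDegenerate P i) (hnd : ∀ i, NonDominated P i) :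
    ∃ (tstar : ℕ) (A : BanditAlgorithm ι), A.IsBIC P ⊤ ∧
      ∀ ω i, ∃ t < tstar, A.recommend t ω = i := by
  obtain ⟨K, ⟨e⟩⟩ := Finite.exists_equiv_fin ι
  -- The negation makes the increasing sort list the arms by decreasing prior mean.
  set f : Fin K → ℝ := fun k => -priorMean P (e.symm k) with hf
  let τ : ℕ → ι := fun k =>
    if hk : k < K then e.symm (Tuple.sort f ⟨k, hk⟩) else Classical.arbitrary ι
  have hτK : ∀ k (hk : k < K), τ k = e.symm (Tuple.sort f ⟨k, hk⟩) := fun k hk => dif_pos hk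
  have hτ : ∀ i, ∃ j < K, τ j = i := fun i => by
    refine ⟨((Tuple.sort f).symm (e i)).val, Fin.isLt _, ?_⟩
    rw [hτK _ (Fin.isLt _)]
    simp
  have hinj : Set.InjOn τ (Set.Iio K) := by
    intro a ha b hb hab
    rw [hτK a ha, hτK b hb] at hab
    simpa [Fin.ext_iff] using hab
  have hanti : ∀ j k, j ≤ k → k < K → priorMean P (τ k) ≤ priorMean P (τ j) := by
    intro j k hjk hk
    have hm := Tuple.monotone_sort f (a := ⟨j, hjk.trans_lt hk⟩) (b := ⟨k, hk⟩) hjk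
    rw [hτK k hk, hτK j (hjk.trans_lt hk)]
    simpa [hf] using hm
  have hev : ∀ᶠ n : ℕ in Filter.atTop, ∀ a j : ι, j ≠ a →
      0 < ∫ x : I, (priorMean P a - x) * (1 - (x : ℝ)) ^ n ∂(P j : Measure I) := by
    refine Filter.eventually_all.2 fun a => Filter.eventually_all.2 fun j => ?_
    by_cases hja : j = a
    · exact Filter.Eventually.of_forall fun _ h => absurd hja h
    · filter_upwards [eventually_integral_sub_mul_pow_pos (P j) (priorMean_le_one P a)
        (hnd a j hja)] with n hn _ using hn
  obtain ⟨n, hn, hn0⟩ := (hev.and (Filter.eventually_gt_atTop 0)).exists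
  have hevL : ∀ᶠ L : ℕ in Filter.atTop, ∀ k ∈ Finset.range K, ∀ j, 0 < failureGap P τ n k j →
      1 ≤ (L - 1 : ℝ) * failureGap P τ n k j := by
    refine (Filter.eventually_all_finset _).2 fun k _ => Filter.eventually_all.2 fun j => ?_
    by_cases hpos : 0 < failureGap P τ n k j
    · have hlim : Filter.Tendsto (fun L : ℕ => (L - 1 : ℝ) * failureGap P τ n k j)
          Filter.atTop Filter.atTop :=
        (Filter.tendsto_atTop_add_const_right _ (-1) tendsto_natCast_atTop_atTop).atTop_mul_const
          hpos
      filter_upwards [hlim.eventually_ge_atTop 1] with L hL _ using hL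
    · exact Filter.Eventually.of_forall fun _ h => absurd h hpos
  -- `L` is chosen after `n`, since the finitely many gaps it must compensate depend on `n`.
  obtain ⟨L, hL, hL0⟩ := (hevL.and (Filter.eventually_gt_atTop 0)).exists
  have : NeZero L := ⟨hL0.ne'⟩
  refine ⟨K * (n * L), stagedExploration P τ K n L, staged_isBIC hP hn0 hτ hinj hanti hn
    fun k hk => hL k (Finset.mem_range.2 hk), fun ω i => ?_⟩
  obtain ⟨j, hj, rfl⟩ := hτ i
  refine ⟨(j * L + (ω.2.2 : Fin L).val) * n + 0, phase_lt _ ?_ hn0,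
    recommend_staged_phase hn0 ω hj hn0⟩
  rwa [Nat.mul_div_cancel _ (Nat.mul_pos hn0 hL0)]

end BanditAlgorithm

end IncentivizedExploration

open IncentivizedExploration
theorem theoremA1 {ι : Type u} [Finite ι] [Nonempty ι] (P : Priors ι)
    (hP : ∀ i, ¬ SupportDegenerate P i) :
    -- an arm is explorable if and only if it satisfies pairwise non-dominance
    (∀ i, Explorable P i ↔ i ∈ nonDominatedArms P) ∧
    -- an algorithm that is guaranteed to be BIC under pairwise non-dominance
    -- remains BIC if it is restricted to the arms in `S`
    (∃ _ : Nonempty (nonDominatedArms P), ∀ (𝒜 : AlgorithmScheme.{u}) (T : ℕ∞),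
      𝒜.GuaranteedBIC T →
        (BanditAlgorithm.ofRestricted
          (𝒜 (nonDominatedArms P) (P.restrict (nonDominatedArms P)))).IsBIC P T) ∧
    -- more generally, this holds for each algorithm that is BIC for the instance with arms `S`,
    -- and in this instance all arms satisfy pairwise non-dominance
    ((∀ i, NonDominated (P.restrict (nonDominatedArms P)) i) ∧
      ∀ (A : BanditAlgorithm (nonDominatedArms P)) (T : ℕ∞),
        A.IsBIC (P.restrict (nonDominatedArms P)) T →
          (BanditAlgorithm.ofRestricted A).IsBIC P T) ∧
    -- some BIC algorithm explores all arms in `S` almost surely by a finite, prior-dependent time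
    (∃ (tstar : ℕ) (A : BanditAlgorithm ι), A.IsBIC P ⊤ ∧
      ∀ᵐ ω ∂(A.law P), ∀ i ∈ nonDominatedArms P, ∃ t < tstar, A.recommend t ω = i) := by
  have hne := nonempty_nonDominatedArms hP
  have hnd : ∀ i, NonDominated (P.restrict (nonDominatedArms P)) i :=
    fun i j hji => i.2 j fun h => hji (Subtype.ext h)
  obtain ⟨tstar, A, hA, hexp⟩ := BanditAlgorithm.exists_isBIC_explores_all
    (P := P.restrict (nonDominatedArms P)) (fun i => hP i) hnd
  have hBIC := BanditAlgorithm.IsBIC.ofRestricted_nonDominatedArms hP hA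
  have hall : ∀ ω, ∀ i ∈ nonDominatedArms P,
      ∃ t < tstar, (BanditAlgorithm.ofRestricted A).recommend t ω = i := by
    intro ω i hi
    obtain ⟨t, ht, h⟩ := hexp (A.restrictOutcome ω) ⟨i, hi⟩
    exact ⟨t, ht, by rw [A.recommend_ofRestricted, h]⟩
  refine ⟨fun i => ⟨fun hi => hi.nonDominated hP, fun hi => ⟨⊤, _, hBIC, ?_⟩⟩,
    ⟨hne, fun 𝒜 T h𝒜 => ?_⟩, ⟨hnd, fun B T hB => ?_⟩,
    ⟨tstar, _, hBIC, Filter.Eventually.of_forall hall⟩⟩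
  · have huniv : {ω | ∃ t : ℕ, (t : ℕ∞) < ⊤ ∧
        (BanditAlgorithm.ofRestricted A).recommend t ω = i} = Set.univ := by
      refine Set.eq_univ_of_forall fun ω => ?_
      obtain ⟨t, -, h⟩ := hall ω i hi
      exact ⟨t, ENat.natCast_lt_top t, h⟩
    rw [huniv, measure_univ]
    exact one_pos
  · exact BanditAlgorithm.IsBIC.ofRestricted_nonDominatedArms hP (h𝒜 _ _ hnd)
  · exact BanditAlgorithm.IsBIC.ofRestricted_nonDominatedArms hP hB
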